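/- Let $n\ge 0$ and $d\ge 2$ be integers. Let $\mathrm{O}(n)$ act on $\mathbb{R}[x_1,\dots,x_n]$ by $(g,f)\mapsto f\circ g^{-1}$ and let $\mathrm{B}(n)\subset \mathrm{O}(n)$ be the group of signed permutation matrices. For $i\ne j$ put $$m_{ij}:=2d\,x_i^{2d-1}x_j-d\,\bigl(x_i^{2d-1}x_j+x_ix_j^{2d-1}\bigr)=d\,\bigl(x_i^{2d-1}x_j-x_ix_j^{2d-1}\bigr),$$ and let $W_1$ be the $\mathrm{B}(n)$-stable real vector space with basis $(m_{ij})_{1\le i<j\le n}$. Let $(c_{ij})_{i<j}$ be the dual basis, and set $c_{ji}:=-c_{ij}$. Let $\mathbb{R}(W_1)=\mathbb{R}(c_{ij}\mid i<j)$ be the field of rational functions on $W_1$ (the fraction field of the ring of polynomial functions on $W_1$), with the induced action of $\mathrm{B}(n)$, and let $\mathbb{R}(W_1)^{\mathrm{B}(n)}$ be the subfield of all $f\in\mathbb{R}(W_1)$ with $g\cdot f=f$ for all $g\in \mathrm{B}(n)$. Put $u_i:=\sum_{j\neq i}c_{ij}^2$ and \begin{align*} p_l&:=\sum_{i<j}c_{ij}^{2l},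 & l&=1,\dots,\tbinom n2,\\ q_l&:=\sum_{i}u_i^{\,l}, & l&=2,\dots,n,\\ z&:=\sum_{i<j<k}(u_i-u_j)(u_j-u_k)(u_k-u_i)\,c_{ij}c_{jk}c_{ki}. \end{align*} Then the field of rational invariants $\mathbb{R}(W_1)^{\mathrm{B}(n)}$ is generated over $\mathbb{R}$ by these polynomials: $$\mathbb{R}(W_1)^{\mathrm{B}(n)}=\mathbb{R}\bigl(p_1,\dots,p_{\binom n2},\,q_2,\dots,q_n,\,z\bigr).$$ -/

import Mathlib

noncomputable section

namespace RationalInvariants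

/-! ### Polynomial functions, rational functions and rational invariants -/

section General

/-- The ring `ℝ[V]` of polynomial functions on a real vector space `V`: the subalgebra of the
functions `V → ℝ` generated by the linear forms. -/
def PolyFun (V : Type*) [AddCommGroup V] [Module ℝ V] : Subalgebra ℝ (V → ℝ) :=
  Algebra.adjoin ℝ (Set.range fun φ : Module.Dual ℝ V => (φ : V → ℝ))

/-- A linear form, as a polynomial function. -/
def linForm {V : Type*} [AddCommGroup V] [Module ℝ V] (φ : Module.Dual ℝ V) : PolyFun V :=
  ⟨fun v => φ v, Algebra.subset_adjoin ⟨φ, rfl⟩⟩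

/-- Every polynomial function is a polynomial in the coordinates of a basis. -/
theorem exists_eval_eq {V : Type*} [AddCommGroup V] [Module ℝ V] {ι : Type*} [Fintype ι]
    (b : Module.Basis ι ℝ V) (f : PolyFun V) :
    ∃ P : MvPolynomial ι ℝ, ∀ v : V, f.1 v = MvPolynomial.eval (fun i => b.repr v i) P := by
  obtain ⟨f, hf⟩ := f
  induction hf using Algebra.adjoin_induction with
  | mem x hx =>
    obtain ⟨φ, rfl⟩ := hx
    refine ⟨∑ i, MvPolynomial.C (φ (b i)) * MvPolynomial.X i, fun v => ?_⟩
    have h : φ v = ∑ i, b.repr v i * φ (b i) := by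
      conv_lhs => rw [← b.sum_repr v]
      simp only [map_sum, map_smul, smul_eq_mul]
    simp [h, mul_comm]
  | algebraMap r => exact ⟨MvPolynomial.C r, fun v => by simp⟩
  | add x y _ _ hx hy =>
    obtain ⟨P, hP⟩ := hx
    obtain ⟨Q, hQ⟩ := hy
    exact ⟨P + Q, fun v => by simp [← hP, ← hQ]⟩
  | mul x y _ _ hx hy =>
    obtain ⟨P, hP⟩ := hx
    obtain ⟨Q, hQ⟩ := hy
    exact ⟨P * Q, fun v => by simp [← hP, ← hQ]⟩

instance instIsDomainPolyFun (V : Type*) [AddCommGroup V] [Module ℝ V] [Module.Finite ℝ V] :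
    IsDomain (PolyFun V) := by
  have hz : NoZeroDivisors (PolyFun V) := by
    refine ⟨fun {f g} hfg => ?_⟩
    let b := Module.finBasis ℝ V
    obtain ⟨P, hP⟩ := exists_eval_eq b f
    obtain ⟨Q, hQ⟩ := exists_eval_eq b g
    have hPQ : P * Q = 0 := by
      refine MvPolynomial.funext fun x => ?_
      have h := congrFun (congrArg Subtype.val hfg) (b.equivFun.symm x)
      have hx : (fun i => b.repr (b.equivFun.symm x) i) = x := b.equivFun.apply_symm_apply x
      have h' : f.1 (b.equivFun.symm x) * g.1 (b.equivFun.symm x) = 0 := h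
      rw [hP, hQ, hx] at h'
      simpa using h'
    rcases mul_eq_zero.1 hPQ with h | h
    · left
      ext v
      simp [hP, h]
    · right
      ext v
      simp [hQ, h]
  have hn : Nontrivial (PolyFun V) :=
    ⟨⟨0, 1, fun h => zero_ne_one (congrFun (congrArg Subtype.val h) 0)⟩⟩
  exact NoZeroDivisors.to_isDomain _

/-- The field `ℝ(V)` of rational functions on `V`, the fraction field of `ℝ[V]`. -/
abbrev RatFun (V : Type*) [AddCommGroup V] [Module ℝ V] : Type _ := FractionRing (PolyFun V)

variable {G V : Type*} [Group G] [AddCommGroup V] [Module ℝ V]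

theorem comp_mem_polyFun (L : V →ₗ[ℝ] V) (f : V → ℝ) (hf : f ∈ PolyFun V) :
    (fun v => f (L v)) ∈ PolyFun V := by
  induction hf using Algebra.adjoin_induction with
  | mem x hx =>
    obtain ⟨φ, rfl⟩ := hx
    exact Algebra.subset_adjoin ⟨φ.comp L, rfl⟩
  | algebraMap r => exact (PolyFun V).algebraMap_mem r
  | add x y _ _ hx hy => exact (PolyFun V).add_mem hx hy
  | mul x y _ _ hx hy => exact (PolyFun V).mul_mem hx hy

/-- The action of `G` on `ℝ[V]` induced by a representation `ρ` of `G` on `V`: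
`(g • f)(v) = f(g⁻¹ v)`. -/
def polyAct (ρ : Representation ℝ G V) : G →* (PolyFun V ≃ₐ[ℝ] PolyFun V) where
  toFun g :=
    { toFun := fun f => ⟨fun v => f.1 (ρ g⁻¹ v), comp_mem_polyFun _ _ f.2⟩
      invFun := fun f => ⟨fun v => f.1 (ρ g v), comp_mem_polyFun _ _ f.2⟩
      left_inv := fun f => by ext v; simp
      right_inv := fun f => by ext v; simp
      map_mul' := fun _ _ => rfl
      map_add' := fun _ _ => rfl
      commutes' := fun _ => rfl }
  map_one' := by ext f v; simp
  map_mul' g h := by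
    ext f v
    change f.1 (ρ (g * h)⁻¹ v) = f.1 (ρ h⁻¹ (ρ g⁻¹ v))
    simp

variable [Module.Finite ℝ V]

/-- The induced action of `G` on `ℝ(V)`. -/
def ratAct (ρ : Representation ℝ G V) : G →* (RatFun V ≃ₐ[ℝ] RatFun V) :=
  (IsFractionRing.fieldEquivOfAlgEquivHom ℝ (RatFun V)).comp (polyAct ρ)

/-- The field `ℝ(V)^G` of rational invariants: all `f` in `ℝ(V)` with `g • f = f` for all `g`. -/
def ratInvariants (ρ : Representation ℝ G V) : IntermediateField ℝ (RatFun V) :=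
  IntermediateField.fixedField (ratAct ρ).range

theorem mem_ratInvariants (ρ : Representation ℝ G V) (f : RatFun V) :
    f ∈ ratInvariants ρ ↔ ∀ g : G, ratAct ρ g f = f := by
  simp [ratInvariants, IntermediateField.mem_fixedField_iff]

end General

/-! ### The orthogonal group and the signed permutation matrices -/

open MvPolynomial in
/-- The representation of `O(n)` on real polynomials in `n` variables, `(g, f) ↦ f ∘ g⁻¹`. -/
def orthRep (n : ℕ) :
    Representation ℝ (Matrix.orthogonalGroup (Fin n) ℝ) (MvPolynomial (Fin n) ℝ) where
  toFun g := (aeval fun i => ∑ j, C ((g⁻¹).1 i j) * X j :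
    MvPolynomial (Fin n) ℝ →ₐ[ℝ] MvPolynomial (Fin n) ℝ).toLinearMap
  map_one' := by
    have h : (aeval fun i => ∑ j, C ((1 : Matrix (Fin n) (Fin n) ℝ) i j) * X j :
        MvPolynomial (Fin n) ℝ →ₐ[ℝ] MvPolynomial (Fin n) ℝ) = AlgHom.id ℝ _ := by
      ext1 i
      simp [Matrix.one_apply]
    rw [inv_one]
    exact congrArg AlgHom.toLinearMap h
  map_mul' g h := by
    have key : (aeval fun i => ∑ j, C (((g * h)⁻¹).1 i j) * X j :
        MvPolynomial (Fin n) ℝ →ₐ[ℝ] MvPolynomial (Fin n) ℝ) =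
        (aeval fun i => ∑ j, C ((g⁻¹).1 i j) * X j :
          MvPolynomial (Fin n) ℝ →ₐ[ℝ] MvPolynomial (Fin n) ℝ).comp
        (aeval fun i => ∑ j, C ((h⁻¹).1 i j) * X j) := by
      ext1 i
      have hm : ((g * h)⁻¹).1 = (h⁻¹).1 * (g⁻¹).1 := by rw [mul_inv_rev]; rfl
      simp only [aeval_X, AlgHom.comp_apply, map_sum, map_mul, algHom_C, hm, Matrix.mul_apply,
        Finset.sum_mul, Finset.mul_sum, algebraMap_eq, mul_assoc]
      exact Finset.sum_comm
    exact congrArg AlgHom.toLinearMap key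

/-- The matrix `g` is the signed permutation matrix with `g e_j = τ_j e_{σ(j)}`. -/
def IsSignedPerm {n : ℕ} (g : Matrix (Fin n) (Fin n) ℝ) (σ : Equiv.Perm (Fin n))
    (τ : Fin n → ℤˣ) : Prop :=
  ∀ i j, g i j = if i = σ j then ((τ j : ℤ) : ℝ) else 0

/-- The group `B(n)` of signed permutation matrices, as a subgroup of `O(n)`. -/
def signedPermGroup (n : ℕ) : Subgroup (Matrix.orthogonalGroup (Fin n) ℝ) where
  carrier := {g | ∃ σ τ, IsSignedPerm g.1 σ τ}
  one_mem' := ⟨1, 1, fun i j => by simp [Matrix.one_apply]⟩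
  mul_mem' := by
    rintro g h ⟨σ, τ, hg⟩ ⟨σ', τ', hh⟩
    refine ⟨σ * σ', fun j => τ (σ' j) * τ' j, fun i j => ?_⟩
    change (g.1 * h.1) i j = _
    simp [Matrix.mul_apply, hg _ _, hh _ _]
  inv_mem' := by
    rintro g ⟨σ, τ, hg⟩
    refine ⟨σ⁻¹, fun j => τ (σ⁻¹ j), fun i j => ?_⟩
    have h : (g⁻¹).1 i j = g.1 j i := rfl
    rw [h, hg]
    by_cases hij : j = σ i
    · subst hij; simp
    · have : i ≠ σ⁻¹ j := fun h' => hij (by rw [h']; simp)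
      rw [if_neg hij, if_neg this]

/-! ### The space `W₁` -/

open MvPolynomial in
/-- The polynomial `m_{ij} = m_μ` for the exponent `μ = (2d-1) ε_i + ε_j`, namely
`(2d choose μ) x^μ - d (x_i^(2d-1) x_j + x_i x_j^(2d-1))`, with `(2d choose μ) = 2d`. -/
def mPoly (n d : ℕ) (i j : Fin n) : MvPolynomial (Fin n) ℝ :=
  C (2 * d : ℝ) * (X i ^ (2 * d - 1) * X j) -
    C (d : ℝ) * (X i ^ (2 * d - 1) * X j + X i * X j ^ (2 * d - 1))

/-- The pairs `i < j` of indices. -/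
abbrev Pairs (n : ℕ) : Type := {e : Fin n × Fin n // e.1 < e.2}

/-- The span `W₁` of the `m_{ij}` with `i < j`. -/
def W₁ (n d : ℕ) : Submodule ℝ (MvPolynomial (Fin n) ℝ) :=
  Submodule.span ℝ (Set.range fun e : Pairs n => mPoly n d e.1.1 e.1.2)

instance instFiniteW₁ (n d : ℕ) : Module.Finite ℝ (W₁ n d) :=
  Module.Finite.span_of_finite ℝ (Set.finite_range _)

theorem mPoly_swap (n d : ℕ) (i j : Fin n) : mPoly n d i j = -mPoly n d j i := by
  simp only [mPoly, map_mul, map_ofNat]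
  ring

theorem mPoly_mem (n d : ℕ) (i j : Fin n) : mPoly n d i j ∈ W₁ n d := by
  rcases lt_trichotomy i j with h | h | h
  · exact Submodule.subset_span ⟨⟨(i, j), h⟩, rfl⟩
  · subst h
    have : mPoly n d i i = 0 := by
      have h2 := mPoly_swap n d i i
      exact self_eq_neg.1 h2
    rw [this]
    exact zero_mem _
  · rw [mPoly_swap]
    exact neg_mem (Submodule.subset_span ⟨⟨(j, i), h⟩, rfl⟩)

open MvPolynomial in
theorem orthRep_mPoly {n d : ℕ} (hd : d ≠ 0) (g : Matrix.orthogonalGroup (Fin n) ℝ)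
    (σ : Equiv.Perm (Fin n)) (τ : Fin n → ℤˣ) (hg : IsSignedPerm g.1 σ τ) (i j : Fin n) :
    orthRep n g (mPoly n d i j) =
      (((τ i * τ j : ℤˣ) : ℤ) : ℝ) • mPoly n d (σ i) (σ j) := by
  have hX : ∀ i, (∑ j, C ((g⁻¹).1 i j) * X j : MvPolynomial (Fin n) ℝ) =
      C (((τ i : ℤˣ) : ℤ) : ℝ) * X (σ i) := by
    intro i
    have h : ∀ j, (g⁻¹).1 i j = g.1 j i := fun _ => rfl
    simp only [h, hg _ _]
    rw [Finset.sum_eq_single (σ i)]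
    · rw [if_pos rfl]
    · intro b _ hb
      rw [if_neg hb, C_0, zero_mul]
    · simp
  have hpow : ∀ s : ℤˣ, (C ((s : ℤ) : ℝ) : MvPolynomial (Fin n) ℝ) ^ (2 * d - 1) =
      C ((s : ℤ) : ℝ) := by
    intro s
    have ho : Odd (2 * d - 1) := ⟨d - 1, by omega⟩
    rcases Int.units_eq_one_or s with rfl | rfl
    · simp
    · simp [ho.neg_one_pow]
  change aeval _ (mPoly n d i j) = _
  simp only [mPoly, map_sub, map_mul, map_add, map_pow, aeval_X, algHom_C, hX, mul_pow, hpow,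
    smul_eq_C_mul, Units.val_mul, Int.cast_mul, algebraMap_eq]
  ring

theorem W₁_stable (n d : ℕ) (g : signedPermGroup n) :
    W₁ n d ≤ (W₁ n d).comap (orthRep n g.1) := by
  refine Submodule.span_le.2 ?_
  rintro _ ⟨e, rfl⟩
  obtain ⟨σ, τ, hg⟩ := g.2
  rcases Nat.eq_zero_or_pos d with rfl | hd
  · simp [mPoly]
  · change orthRep n g.1 (mPoly n d _ _) ∈ W₁ n d
    rw [orthRep_mPoly hd.ne' g.1 σ τ hg]
    exact Submodule.smul_mem _ _ (mPoly_mem _ _ _ _)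

/-- The representation of `B(n)` on `W₁`, the restriction of the representation of `O(n)`. -/
def repW₁ (n d : ℕ) : Representation ℝ (signedPermGroup n) (W₁ n d) :=
  Representation.subrepresentation ((orthRep n).comp (signedPermGroup n).subtype) (W₁ n d)
    (W₁_stable n d)

open MvPolynomial in
theorem mPoly_linearIndependent (n d : ℕ) (hd : 2 ≤ d) :
    LinearIndependent ℝ (fun e : Pairs n => mPoly n d e.1.1 e.1.2) := by
  have key : ∀ e e' : Pairs n,
      coeff (Finsupp.single e.1.1 (2 * d - 1) + Finsupp.single e.1.2 1)
        (mPoly n d e'.1.1 e'.1.2) = if e' = e then (d : ℝ) else 0 := by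
    rintro ⟨⟨i, j⟩, hij⟩ ⟨⟨k, l⟩, hkl⟩
    simp only at hij hkl
    have h1 : ∀ a b : Fin n, (X a ^ (2 * d - 1) * X b : MvPolynomial (Fin n) ℝ) =
        monomial (Finsupp.single a (2 * d - 1) + Finsupp.single b 1) 1 := by
      intro a b
      rw [X_pow_eq_monomial, X, monomial_mul, one_mul]
    have h2 : ∀ a b : Fin n, a ≠ b →
        (Finsupp.single a (2 * d - 1) + Finsupp.single b 1 =
          (Finsupp.single i (2 * d - 1) + Finsupp.single j 1 : Fin n →₀ ℕ) ↔ a = i ∧ b = j) := by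
      intro a b hab
      refine ⟨fun h => ?_, fun h => by rw [h.1, h.2]⟩
      have ha := DFunLike.congr_fun h a
      have hb := DFunLike.congr_fun h b
      simp only [Finsupp.add_apply, Finsupp.single_apply] at ha hb
      have hij' : i ≠ j := hij.ne
      have hai : a = i := by
        by_contra hne
        simp only [hab.symm, Ne.symm hne, if_true, if_false] at ha
        split_ifs at ha <;> omega
      subst hai
      refine ⟨rfl, ?_⟩
      by_contra hne
      simp [hab, Ne.symm hne] at hb
    have h3 : mPoly n d k l =
        C (2 * d : ℝ) * (X k ^ (2 * d - 1) * X l) -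
          C (d : ℝ) * (X k ^ (2 * d - 1) * X l + X l ^ (2 * d - 1) * X k) := by
      simp only [mPoly, mul_comm (X k) (X l ^ (2 * d - 1))]
    have h4 : ¬(l = i ∧ k = j) := by
      rintro ⟨rfl, rfl⟩
      exact absurd hij hkl.asymm
    rw [h3]
    simp only [h1, coeff_sub, coeff_C_mul, coeff_add, coeff_monomial, h2 k l hkl.ne,
      h2 l k hkl.ne', h4, if_false, Subtype.mk.injEq, Prod.mk.injEq]
    split_ifs <;> ring
  rw [Fintype.linearIndependent_iff]
  intro a ha e
  have h := congrArg (coeff (Finsupp.single e.1.1 (2 * d - 1) + Finsupp.single e.1.2 1)) ha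
  simp only [coeff_sum, coeff_smul, key, coeff_zero, smul_eq_mul, mul_ite, mul_zero,
    Finset.sum_ite_eq', Finset.mem_univ, if_true] at h
  have hd0 : (d : ℝ) ≠ 0 := by positivity
  exact (mul_eq_zero.1 h).resolve_right hd0

/-- The basis `m_{ij}`, `i < j`, of `W₁`. -/
def basisW₁ (n d : ℕ) (hd : 2 ≤ d) : Module.Basis (Pairs n) ℝ (W₁ n d) :=
  Module.Basis.span (mPoly_linearIndependent n d hd)

/-! ### The invariants -/

/-- The function `c_{ij}` on `W₁`: for `i < j` the element of the dual basis belonging to `m_{ij}`,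
extended to all indices by `c_{ij} = -c_{ji}`. -/
def c {n d : ℕ} (hd : 2 ≤ d) (i j : Fin n) : RatFun (W₁ n d) :=
  if h : i < j then algebraMap _ _ (linForm ((basisW₁ n d hd).coord ⟨(i, j), h⟩))
  else if h : j < i then -algebraMap _ _ (linForm ((basisW₁ n d hd).coord ⟨(j, i), h⟩))
  else 0

/-- `u_i = ∑_{j ≠ i} c_{ij}²`. -/
def u {n d : ℕ} (hd : 2 ≤ d) (i : Fin n) : RatFun (W₁ n d) :=
  ∑ j with j ≠ i, c hd i j ^ 2

/-- `p_l = ∑_{i<j} c_{ij}^{2l}`. -/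
def p (n : ℕ) {d : ℕ} (hd : 2 ≤ d) (l : ℕ) : RatFun (W₁ n d) :=
  ∑ i : Fin n, ∑ j with i < j, c hd i j ^ (2 * l)

/-- `q_l = ∑_i u_i^l`. -/
def q (n : ℕ) {d : ℕ} (hd : 2 ≤ d) (l : ℕ) : RatFun (W₁ n d) :=
  ∑ i : Fin n, u hd i ^ l

/-- `z = ∑_{i<j<k} (u_i - u_j)(u_j - u_k)(u_k - u_i) c_{ij} c_{jk} c_{ki}`. -/
def z (n : ℕ) {d : ℕ} (hd : 2 ≤ d) : RatFun (W₁ n d) :=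
  ∑ i : Fin n, ∑ j with i < j, ∑ k with j < k,
    (u hd i - u hd j) * (u hd j - u hd k) * (u hd k - u hd i) * (c hd i j * c hd j k * c hd k i)

end RationalInvariants

end

/-! Let `K` be the field generated by the `p_l`, `q_l` and `z`, and `F` the field of rational
functions. By Newton's identities the `p_l` put the coefficients of `∏ (X² - c_{ij}²)` in `K`, and
its roots generate `F`, so `F/K` is finite Galois (`isGalois_of_powerSums_sq_mem`). The generators
are invariant (`map_invariants_eq`), so it remains to show that every `φ` in the Galois group acts
as an element of `B(n)`; an invariant is then fixed by the whole group and lies in `K`.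

The `q_l`, with `∑ u_i = 2 p_1`, force `φ` to permute the `u_i` by some `σ`, and the `p_l` force it
to permute the `c_{ij}²`. These permutations are compatible: `φ(c_{ij}²)` is a summand of both `u_{σ
i}` and `u_{σ j}`, hence equals `c_{σ i, σ j}²` (`map_c_sq_eq`). So `φ(c_{ij}) = ε_{ij} c_{σ i, σ
j}` with signs `ε_{ij}`. Invariance of `z` makes the product of the signs around each triangle `1`
(`sign_triangle`), which means `ε_{ij} = τ_i τ_j` (`exists_signs`). The pair `(σ, τ)` is the
required signed permutation.

Both rigidity steps test a polynomial relation at a well-chosen real antisymmetric matrix, where all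
terms have the same sign. -/

namespace RationalInvariants

/-! ### Symmetric functions and intermediate fields -/

/-- Equal multiplicities make the fibres of `f` and `g` over each value equinumerous; bijections
between the fibres glue to a permutation. -/
theorem exists_perm_of_map_univ_eq {ι α : Type*} [Fintype ι] (f g : ι → α)
    (h : Finset.univ.val.map f = Finset.univ.val.map g) :
    ∃ σ : Equiv.Perm ι, ∀ i, f i = g (σ i) := by
  classical
  have hc : ∀ a, Nonempty ({i // f i = a} ≃ {i // g i = a}) := fun a => by
    refine ⟨Fintype.equivOfCardEq ?_⟩
    have := congrArg (Multiset.count a) h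
    simp only [Multiset.count_map] at this
    rw [Fintype.card_subtype, Fintype.card_subtype, Finset.card_def, Finset.card_def]
    simpa [Finset.filter_val, eq_comm] using this
  exact ⟨Equiv.ofFiberEquiv fun a => (hc a).some, fun i => (Equiv.ofFiberEquiv_map _ i).symm⟩

section Symmetric

variable {k F ι : Type*} [Field k] [Field F] [Algebra k F] [CharZero F] [Fintype ι]

/-- Newton's identities express `m • e_m` through power sums and earlier `e_a`; characteristic zero
allows division by `m`. -/
theorem aeval_esymm_mem_of_powerSums (K : IntermediateField k F) (s : ι → F)
    (hs : ∀ l, 1 ≤ l → l ≤ Fintype.card ι → ∑ i, s i ^ l ∈ K) (m : ℕ)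
    (hm : m ≤ Fintype.card ι) : MvPolynomial.aeval s (MvPolynomial.esymm ι ℤ m) ∈ K := by
  classical
  induction m using Nat.strong_induction_on with
  | _ m ih =>
    rcases Nat.eq_zero_or_pos m with rfl | h0
    · simp
    have h := congrArg (MvPolynomial.aeval s) (MvPolynomial.mul_esymm_eq_sum ι ℤ m)
    have hm0 : (m : F) ≠ 0 := Nat.cast_ne_zero.2 h0.ne'
    simp only [map_mul, map_natCast, map_pow, map_neg, map_one, map_sum] at h
    rw [← mul_right_inj' (inv_ne_zero hm0), inv_mul_cancel_left₀ hm0] at h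
    rw [h]
    refine K.mul_mem (K.inv_mem (natCast_mem K m)) (K.mul_mem
      (pow_mem (neg_mem K.one_mem) _) (sum_mem fun a ha => ?_))
    obtain ⟨ha1, ha2⟩ := Finset.mem_filter.1 ha
    have ha1 := Finset.HasAntidiagonal.mem_antidiagonal.1 ha1
    refine K.mul_mem (K.mul_mem (pow_mem (neg_mem K.one_mem) _) (ih _ ha2 (by omega))) ?_
    simpa [MvPolynomial.psum] using hs a.2 (by omega) (by omega)

open Polynomial in
theorem exists_map_eq_prod_X_sub_C (K : IntermediateField k F) (s : ι → F)
    (hs : ∀ l, 1 ≤ l → l ≤ Fintype.card ι → ∑ i, s i ^ l ∈ K) :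
    ∃ P : K[X], P.map (algebraMap K F) = ∏ i, (X - C (s i)) := by
  rw [← mem_lifts]
  have h : ∏ i, (X - C (s i)) = ((Finset.univ.val.map s).map fun t => X - C t).prod := by
    rw [Multiset.map_map]; rfl
  rw [h, Multiset.prod_X_sub_X_eq_sum_esymm]
  refine sum_mem fun m hm => ?_
  have hK : (-1) ^ m * (Finset.univ.val.map s).esymm m ∈ K := by
    rw [← MvPolynomial.aeval_esymm_eq_multiset_esymm ι ℤ]
    refine K.mul_mem (pow_mem (neg_mem K.one_mem) _) (aeval_esymm_mem_of_powerSums K s hs m ?_)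
    simpa [Nat.lt_succ_iff] using hm
  refine (mem_lifts _).2 ⟨C ⟨_, hK⟩ * X ^ (Fintype.card ι - m), ?_⟩
  rw [Polynomial.map_mul, map_C, Polynomial.map_pow, map_X]
  simp [mul_assoc]

open Polynomial in
/-- An automorphism over a field containing the power sums of a finite family permutes it. -/
theorem exists_perm_of_powerSums_mem (K : IntermediateField k F) (s : ι → F)
    (hs : ∀ l, 1 ≤ l → l ≤ Fintype.card ι → ∑ i, s i ^ l ∈ K) (φ : Gal(F/K)) :
    ∃ σ : Equiv.Perm ι, ∀ i, φ (s i) = s (σ i) := by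
  obtain ⟨P, hP⟩ := exists_map_eq_prod_X_sub_C K s hs
  have hφ : (φ : F →+* F).comp (algebraMap K F) = algebraMap K F := by
    ext x; exact φ.commutes x
  have h := congrArg (Polynomial.map (φ : F →+* F)) hP
  rw [Polynomial.map_map, hφ, hP, Polynomial.map_prod] at h
  simp only [Polynomial.map_sub, map_X, map_C] at h
  refine exists_perm_of_map_univ_eq (fun i => φ (s i)) s ?_
  have hr : ∀ t : ι → F, (∏ i, (X - C (t i))).roots = Finset.univ.val.map t := fun t => by
    rw [← roots_multiset_prod_X_sub_C (Finset.univ.val.map t), Multiset.map_map]; rfl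
  have h' := congrArg Polynomial.roots h
  rw [hr, hr] at h'
  exact h'.symm

open Polynomial in
/-- A field generated by square roots of the members of a finite family is Galois over every
intermediate field containing the power sums of this family. -/
theorem isGalois_of_powerSums_sq_mem (K : IntermediateField k F) (s : ι → F)
    (hs : ∀ l, 1 ≤ l → l ≤ Fintype.card ι → ∑ i, (s i ^ 2) ^ l ∈ K)
    (htop : IntermediateField.adjoin k (Set.range s) = ⊤) :
    FiniteDimensional K F ∧ IsGalois K F := by
  obtain ⟨P, hP⟩ := exists_map_eq_prod_X_sub_C K (fun i => s i ^ 2) hs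
  obtain ⟨Q, hQ⟩ : ∃ Q : K[X],
      Q.map (algebraMap K F) = ∏ i, ((X - C (s i)) * (X + C (s i))) := by
    -- Substituting `X²` for `X` turns each factor `X - s_i²` into `(X - s_i)(X + s_i)`.
    refine ⟨expand K 2 P, ?_⟩
    rw [map_expand, hP, map_prod]
    refine Finset.prod_congr rfl fun i _ => ?_
    rw [map_sub, expand_X, expand_C, C_pow]
    ring
  have hne : Q.map (algebraMap K F) ≠ 0 := by
    rw [hQ]
    exact Finset.prod_ne_zero_iff.2 fun i _ => mul_ne_zero (X_sub_C_ne_zero _) (X_add_C_ne_zero _)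
  have hsplit : Q.IsSplittingField K F := by
    rw [isSplittingField_iff_intermediateField]
    constructor
    · rw [hQ]
      exact Splits.prod fun i _ => (Splits.X_sub_C _).mul (Splits.X_add_C _)
    · rw [← IntermediateField.restrictScalars_eq_top_iff (K := k), eq_top_iff, ← htop,
        IntermediateField.adjoin_le_iff]
      rintro _ ⟨i, rfl⟩
      suffices h : s i ∈ Q.rootSet F from
        (IntermediateField.mem_restrictScalars k).2 (IntermediateField.subset_adjoin K _ h)
      rw [mem_rootSet']
      refine ⟨hne, ?_⟩
      rw [aeval_def, ← eval_map, hQ, eval_prod]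
      exact Finset.prod_eq_zero (Finset.mem_univ i) (by simp)
  have hfin := IsSplittingField.finiteDimensional F Q
  have hn := Normal.of_isSplittingField (E := F) Q
  have : CharZero K := ⟨fun a b h => Nat.cast_injective (R := F) (congrArg (algebraMap K F) h)⟩
  have hsep : Algebra.IsSeparable K F := inferInstance
  exact ⟨hfin, { to_isSeparable := hsep, to_normal := hn }⟩

end Symmetric

theorem mem_of_forall_gal_eq {k F : Type*} [Field k] [Field F] [Algebra k F]
    (K : IntermediateField k F) [FiniteDimensional K F] [IsGalois K F] {x : F}
    (hx : ∀ φ : Gal(F/K), φ x = x) : x ∈ K := by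
  obtain ⟨y, rfl⟩ := IntermediateField.mem_bot.1 ((IsGalois.mem_bot_iff_fixed x).2 hx)
  exact y.2

/-! ### The coordinates `c_{ij}` and the action of `B(n)` -/

section Coordinates

variable {n d : ℕ} (hd : 2 ≤ d)

/-- The polynomial function `c_{ij}` on `W₁`, for all indices `i` and `j`. -/
noncomputable def cPoly (i j : Fin n) : PolyFun (W₁ n d) :=
  if h : i < j then linForm ((basisW₁ n d hd).coord ⟨(i, j), h⟩)
  else if h : j < i then -linForm ((basisW₁ n d hd).coord ⟨(j, i), h⟩)
  else 0

theorem algebraMap_cPoly (i j : Fin n) :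
    algebraMap _ (RatFun (W₁ n d)) (cPoly hd i j) = c hd i j := by
  unfold cPoly c
  split_ifs <;> simp

theorem c_swap (i j : Fin n) : c (d := d) hd j i = -c hd i j := by
  rcases lt_trichotomy i j with h | h | h
  · simp [c, h, h.asymm]
  · subst h; simp [c]
  · simp [c, h, h.asymm]

theorem c_self (i : Fin n) : c (d := d) hd i i = 0 := by simp [c]

/-- The entries above the diagonal serve as coordinates in the basis `m_{ij}`. Relations between the
`c_{ij}` can thus be tested at freely chosen real matrices, where positivity is available. -/
theorem exists_cPoly_apply (A : Fin n → Fin n → ℝ) (hA : ∀ i j, A j i = -A i j) :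
    ∃ v : W₁ n d, ∀ i j, (cPoly hd i j).1 v = A i j := by
  refine ⟨(basisW₁ n d hd).equivFun.symm fun e => A e.1.1 e.1.2, fun i j => ?_⟩
  have key : ∀ e : Pairs n, (linForm ((basisW₁ n d hd).coord e)).1
      ((basisW₁ n d hd).equivFun.symm fun e => A e.1.1 e.1.2) = A e.1.1 e.1.2 := fun e => by
    change (basisW₁ n d hd).repr _ e = _
    exact congrFun ((basisW₁ n d hd).equivFun.apply_symm_apply fun e => A e.1.1 e.1.2) e
  unfold cPoly
  split_ifs with h1 h2
  · exact key _
  · change -(linForm ((basisW₁ n d hd).coord ⟨(j, i), h2⟩)).1 _ = _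
    rw [key, hA i j, neg_neg]
  · have : i = j := le_antisymm (not_lt.1 h2) (not_lt.1 h1)
    subst this
    change (0 : ℝ) = _
    linarith [hA i i]

/-- A polynomial relation between the `c_{ij}` holds for all antisymmetric matrices. -/
theorem eval_eq_zero_of_aeval_c_eq_zero (P : MvPolynomial (Fin n × Fin n) ℝ)
    (hP : MvPolynomial.aeval (fun e : Fin n × Fin n => c (d := d) hd e.1 e.2) P = 0)
    (A : Fin n → Fin n → ℝ) (hA : ∀ i j, A j i = -A i j) :
    MvPolynomial.eval (fun e => A e.1 e.2) P = 0 := by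
  obtain ⟨v, hv⟩ := exists_cPoly_apply hd A hA
  have h1 : MvPolynomial.aeval (fun e : Fin n × Fin n => cPoly (d := d) hd e.1 e.2) P = 0 := by
    apply IsFractionRing.injective (PolyFun (W₁ n d)) (RatFun (W₁ n d))
    rw [map_zero, ← hP, ← MvPolynomial.aeval_algebraMap_apply]
    exact congrArg (fun f => MvPolynomial.aeval f P)
      (funext fun e : Fin n × Fin n => algebraMap_cPoly hd e.1 e.2)
  let ev : PolyFun (W₁ n d) →ₐ[ℝ] ℝ :=
    (Pi.evalAlgHom ℝ (fun _ : W₁ n d => ℝ) v).comp (PolyFun (W₁ n d)).val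
  have h2 := congrArg ev h1
  rw [map_zero, MvPolynomial.comp_aeval_apply] at h2
  have h3 : (fun e : Fin n × Fin n => ev (cPoly hd e.1 e.2)) = fun e => A e.1 e.2 :=
    funext fun e => hv e.1 e.2
  rwa [h3, MvPolynomial.aeval_eq_eval] at h2

/-- The `c_{ij}` with `i < j` generate the field of rational functions. -/
theorem adjoin_c_eq_top : IntermediateField.adjoin ℝ
    (Set.range fun e : Pairs n => c (d := d) hd e.1.1 e.1.2) = ⊤ := by
  set L := IntermediateField.adjoin ℝ (Set.range fun e : Pairs n => c (d := d) hd e.1.1 e.1.2)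
  have hform : ∀ φ : Module.Dual ℝ (W₁ n d), algebraMap _ (RatFun (W₁ n d)) (linForm φ) ∈ L := by
    intro φ
    have h : linForm φ = ∑ e, φ (basisW₁ n d hd e) • linForm ((basisW₁ n d hd).coord e) := by
      ext v
      have hv : φ v = ∑ e, (basisW₁ n d hd).repr v e * φ (basisW₁ n d hd e) := by
        conv_lhs => rw [← (basisW₁ n d hd).sum_repr v]
        simp only [map_sum, map_smul, smul_eq_mul]
      have hs : (↑(∑ e, φ (basisW₁ n d hd e) • linForm ((basisW₁ n d hd).coord e)) :
          W₁ n d → ℝ) = ∑ e, φ (basisW₁ n d hd e) • ⇑((basisW₁ n d hd).coord e) := by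
        push_cast; rfl
      rw [hs]
      simp only [Finset.sum_apply, Pi.smul_apply, smul_eq_mul, Module.Basis.coord_apply]
      rw [show (linForm φ).1 v = φ v from rfl, hv]
      exact Finset.sum_congr rfl fun e _ => mul_comm _ _
    rw [h, map_sum]
    refine sum_mem fun e _ => ?_
    rw [algebra_compatible_smul (PolyFun (W₁ n d)), smul_eq_mul, map_mul,
      ← IsScalarTower.algebraMap_apply]
    refine L.mul_mem (L.algebraMap_mem _) (IntermediateField.subset_adjoin _ _ ⟨e, ?_⟩)
    simp [c, e.2]
  have hpoly : ∀ f : PolyFun (W₁ n d), algebraMap _ (RatFun (W₁ n d)) f ∈ L := by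
    rintro ⟨f, hf⟩
    induction hf using Algebra.adjoin_induction with
    | mem x hx => obtain ⟨φ, rfl⟩ := hx; exact hform φ
    | algebraMap r =>
      have h := IsScalarTower.algebraMap_apply ℝ (PolyFun (W₁ n d)) (RatFun (W₁ n d)) r
      exact h ▸ L.algebraMap_mem r
    | add x y hx hy h1 h2 =>
      have h := map_add (algebraMap (PolyFun (W₁ n d)) (RatFun (W₁ n d))) ⟨x, hx⟩ ⟨y, hy⟩
      exact h ▸ L.add_mem h1 h2
    | mul x y hx hy h1 h2 =>
      have h := map_mul (algebraMap (PolyFun (W₁ n d)) (RatFun (W₁ n d))) ⟨x, hx⟩ ⟨y, hy⟩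
      exact h ▸ L.mul_mem h1 h2
  refine eq_top_iff.2 fun x _ => ?_
  obtain ⟨a, b, -, rfl⟩ := IsFractionRing.div_surjective (PolyFun (W₁ n d)) x
  exact L.div_mem (hpoly a) (hpoly b)

/-- The antisymmetric pairing is needed for all indices because a permutation does not preserve `i <
j`. For `k = l` the two terms cancel, in accordance with `m_{kk} = 0`. -/
theorem cPoly_mPoly (i j k l : Fin n) :
    (cPoly hd i j).1 (⟨mPoly n d k l, mPoly_mem n d k l⟩ : W₁ n d) =
      (if i = k ∧ j = l then 1 else 0) - (if i = l ∧ j = k then 1 else 0) := by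
  have hlt : ∀ (k l : Fin n) (h : k < l) (i j : Fin n),
      (cPoly hd i j).1 (⟨mPoly n d k l, mPoly_mem n d k l⟩ : W₁ n d) =
      (if i = k ∧ j = l then 1 else 0) - (if i = l ∧ j = k then 1 else 0) := by
    intro k l h i j
    have hb : (⟨mPoly n d k l, mPoly_mem n d k l⟩ : W₁ n d) = basisW₁ n d hd ⟨(k, l), h⟩ :=
      (Module.Basis.span_apply (mPoly_linearIndependent n d hd) ⟨(k, l), h⟩).symm
    have hcoord : ∀ e : Pairs n, (linForm ((basisW₁ n d hd).coord e)).1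
        (basisW₁ n d hd ⟨(k, l), h⟩) = if e.1.1 = k ∧ e.1.2 = l then 1 else 0 := fun e => by
      change (basisW₁ n d hd).repr _ e = _
      rw [Module.Basis.repr_self, Finsupp.single_apply]
      refine if_congr ?_ rfl rfl
      rw [eq_comm, Subtype.ext_iff, Prod.ext_iff]
    rw [hb]
    unfold cPoly
    split_ifs with h1 h2 h3 h4 h5 h6 h7 h8 h9
    all_goals first
      | rw [hcoord]
      | (change -(linForm _).1 _ = _; rw [hcoord])
      | (change (0 : ℝ) = _)
    all_goals grind
  rcases lt_trichotomy k l with h | h | h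
  · exact hlt k l h i j
  · subst h
    have : (⟨mPoly n d k k, mPoly_mem n d k k⟩ : W₁ n d) = 0 :=
      Subtype.ext (self_eq_neg.1 (mPoly_swap n d k k))
    rw [this]
    unfold cPoly
    split_ifs
    all_goals first
      | (change (0 : ℝ) = _; simp_all)
      | (change (basisW₁ n d hd).coord _ 0 = _; simp_all)
      | (change -(basisW₁ n d hd).coord _ 0 = _; simp_all)
  · have h' : (⟨mPoly n d k l, mPoly_mem n d k l⟩ : W₁ n d) =
        -⟨mPoly n d l k, mPoly_mem n d l k⟩ := Subtype.ext (mPoly_swap n d k l)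
    have hneg : ∀ w : W₁ n d, (cPoly hd i j).1 (-w) = -(cPoly hd i j).1 w := fun w => by
      unfold cPoly
      split_ifs
      · exact map_neg ((basisW₁ n d hd).coord _) w
      · exact congrArg Neg.neg (map_neg ((basisW₁ n d hd).coord _) w)
      · exact (neg_zero (G := ℝ)).symm
    rw [h', hneg, hlt l k h]
    ring

/-- `c_{ij}` as a linear form. -/
theorem exists_dual_cPoly (i j : Fin n) :
    ∃ φ : Module.Dual ℝ (W₁ n d), ∀ v, (cPoly hd i j).1 v = φ v := by
  unfold cPoly
  split_ifs with h1 h2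
  · exact ⟨(basisW₁ n d hd).coord ⟨(i, j), h1⟩, fun _ => rfl⟩
  · exact ⟨-(basisW₁ n d hd).coord ⟨(j, i), h2⟩, fun _ => rfl⟩
  · exact ⟨0, fun _ => rfl⟩

/-- Both sides are linear forms in `w`, so they are compared on the basis `m_{kl}`, where the sign
from the action cancels the sign on the left. -/
theorem cPoly_repW₁ (g : signedPermGroup n) {σ : Equiv.Perm (Fin n)} {τ : Fin n → ℤˣ}
    (hg : IsSignedPerm g.1.1 σ τ) (i j : Fin n) (w : W₁ n d) :
    (((τ i * τ j : ℤˣ) : ℤ) : ℝ) * (cPoly hd (σ i) (σ j)).1 (repW₁ n d g w) =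
      (cPoly hd i j).1 w := by
  obtain ⟨φ, hφ⟩ := exists_dual_cPoly (n := n) hd i j
  obtain ⟨ψ, hψ⟩ := exists_dual_cPoly (n := n) hd (σ i) (σ j)
  rw [hφ, hψ]
  suffices h : (((τ i * τ j : ℤˣ) : ℤ) : ℝ) • ψ.comp (repW₁ n d g) = φ from
    LinearMap.congr_fun h w
  refine (basisW₁ n d hd).ext fun e => ?_
  obtain ⟨⟨k, l⟩, hkl⟩ := e
  have hb : basisW₁ n d hd ⟨(k, l), hkl⟩ = ⟨mPoly n d k l, mPoly_mem n d k l⟩ :=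
    Module.Basis.span_apply (mPoly_linearIndependent n d hd) ⟨(k, l), hkl⟩
  have hr : repW₁ n d g ⟨mPoly n d k l, mPoly_mem n d k l⟩ =
      (((τ k * τ l : ℤˣ) : ℤ) : ℝ) • ⟨mPoly n d (σ k) (σ l), mPoly_mem n d (σ k) (σ l)⟩ :=
    Subtype.ext (orthRep_mPoly (by omega) g.1 σ τ hg k l)
  rw [hb, LinearMap.smul_apply, LinearMap.comp_apply, hr, map_smul, ← hψ, ← hφ, cPoly_mPoly,
    cPoly_mPoly]
  have hs : ∀ s : ℤˣ, (((s : ℤ) : ℝ)) * ((s : ℤ) : ℝ) = 1 := fun s => by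
    rcases Int.units_eq_one_or s with rfl | rfl <;> simp
  simp only [smul_eq_mul, σ.injective.eq_iff, Units.val_mul, Int.cast_mul]
  by_cases h1 : i = k ∧ j = l
  · obtain ⟨rfl, rfl⟩ := h1
    have hij : ¬(i = j ∧ j = i) := fun h => hkl.ne h.1
    rw [if_pos ⟨rfl, rfl⟩, if_neg hij]
    linear_combination (((τ i : ℤ) : ℝ) * (τ i : ℤ)) * hs (τ j) + hs (τ i)
  by_cases h2 : i = l ∧ j = k
  · obtain ⟨rfl, rfl⟩ := h2
    rw [if_neg h1, if_pos ⟨rfl, rfl⟩]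
    linear_combination -(((τ i : ℤ) : ℝ) * (τ i : ℤ)) * hs (τ j) - hs (τ i)
  · simp [h1, h2]

theorem ratAct_c (g : signedPermGroup n) {σ : Equiv.Perm (Fin n)} {τ : Fin n → ℤˣ}
    (hg : IsSignedPerm g.1.1 σ τ) (i j : Fin n) :
    ratAct (repW₁ n d) g (c hd i j) = ((τ i * τ j : ℤˣ) : ℤ) * c hd (σ i) (σ j) := by
  have h : polyAct (repW₁ n d) g (cPoly hd i j) =
      ((τ i * τ j : ℤˣ) : ℤ) * cPoly hd (σ i) (σ j) := by
    ext v
    -- The induced action is `f(g⁻¹ v)`, so the formula is used at the point `g⁻¹ v`.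
    have h1 := cPoly_repW₁ hd g hg i j (repW₁ n d g⁻¹ v)
    rw [Representation.self_inv_apply] at h1
    change (cPoly hd i j).1 (repW₁ n d g⁻¹ v) = _
    rw [← h1]
    simp
  rw [← algebraMap_cPoly, ← algebraMap_cPoly]
  change IsFractionRing.fieldEquivOfAlgEquiv ℝ _ _ (polyAct (repW₁ n d) g) _ = _
  rw [IsFractionRing.fieldEquivOfAlgEquiv_algebraMap, h]
  simp

/-- Every pair of a permutation and a sign vector comes from an element of `B(n)`. -/
theorem exists_isSignedPerm (σ : Equiv.Perm (Fin n)) (τ : Fin n → ℤˣ) :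
    ∃ g : signedPermGroup n, IsSignedPerm g.1.1 σ τ := by
  let M : Matrix (Fin n) (Fin n) ℝ := Matrix.of fun i j => if i = σ j then ((τ j : ℤ) : ℝ) else 0
  have hM : M ∈ Matrix.orthogonalGroup (Fin n) ℝ := by
    rw [Matrix.mem_orthogonalGroup_iff']
    ext i j
    rw [Matrix.mul_apply]
    change ∑ l, (if l = σ i then ((τ i : ℤ) : ℝ) else 0) *
      (if l = σ j then ((τ j : ℤ) : ℝ) else 0) = _
    simp only [ite_mul, zero_mul, Finset.sum_ite_eq', Finset.mem_univ, if_true,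
      σ.injective.eq_iff, Matrix.one_apply]
    split_ifs with h
    · subst h
      rcases Int.units_eq_one_or (τ i) with h | h <;> simp [h]
    · simp
  exact ⟨⟨⟨M, hM⟩, σ, τ, fun _ _ => rfl⟩, fun _ _ => rfl⟩

end Coordinates

/-! ### Sums over pairs and triples of indices -/

section Sums

variable {n : ℕ} {R : Type*}

theorem sum_sum_eq_two_mul [CommSemiring R] (f : Fin n → Fin n → R) (h0 : ∀ i, f i i = 0)
    (hs : ∀ i j, f j i = f i j) :
    ∑ i, ∑ j, f i j = 2 * ∑ i, ∑ j with i < j, f i j := by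
  have h : ∀ i j, f i j = (if i < j then f i j else 0) + (if j < i then f j i else 0) := by
    intro i j
    rcases lt_trichotomy i j with h | h | h
    · simp [h, h.asymm]
    · simp [h, h0]
    · simp [h, h.asymm, hs]
  simp only [Finset.sum_filter]
  rw [two_mul]
  conv_rhs => rhs; rw [Finset.sum_comm]
  simp only [← Finset.sum_add_distrib, ← h]

/-- A symmetric summand vanishing on coinciding indices takes each unordered triple six times.
Unlike the sum over `i < j < k`, the full sum can be reindexed by a permutation. -/
theorem sum_sum_sum_eq_six_mul [CommSemiring R] (f : Fin n → Fin n → Fin n → R)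
    (h0 : ∀ i j, f i i j = 0) (h1 : ∀ i j k, f j i k = f i j k)
    (h2 : ∀ i j k, f i k j = f i j k) :
    ∑ i, ∑ j, ∑ k, f i j k = 6 * ∑ i, ∑ j with i < j, ∑ k with j < k, f i j k := by
  let T : Fin n → Fin n → Fin n → R := fun i j k => if i < j ∧ j < k then f i j k else 0
  have hT : ∑ i, ∑ j with i < j, ∑ k with j < k, f i j k = ∑ i, ∑ j, ∑ k, T i j k := by
    simp only [Finset.sum_filter]
    refine Finset.sum_congr rfl fun i _ => Finset.sum_congr rfl fun j _ => ?_
    split_ifs with h <;> simp [T, h]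
  have hf : ∀ i j k, f i j k = T i j k + T i k j + T j i k + T j k i + T k i j + T k j i := by
    intro i j k
    have e1 := h1 i j k
    have e2 := h2 i j k
    have e3 : f j k i = f i j k := by rw [h2, h1]
    have e4 : f k i j = f i j k := by rw [h1, h2]
    have e5 : f k j i = f i j k := by rw [h1, h2, h1]
    simp only [T, e1, e2, e3, e4, e5]
    rcases lt_trichotomy i j with h | h | h
    · rcases lt_trichotomy j k with h' | h' | h'
      · simp [h, h', h.asymm, h'.asymm, (h.trans h').asymm]
      · subst h'
        have : f i j j = 0 := by rw [← e3, h0]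
        simp [this]
      · rcases lt_trichotomy i k with h'' | h'' | h''
        · simp [h, h', h'', h.asymm, h'.asymm, h''.asymm]
        · subst h''
          have : f i j i = 0 := by rw [h2, h0]
          simp [this]
        · simp [h, h', h'', h.asymm, h'.asymm, h''.asymm]
    · subst h; simp [h0]
    · rcases lt_trichotomy j k with h' | h' | h'
      · rcases lt_trichotomy i k with h'' | h'' | h''
        · simp [h, h', h'', h.asymm, h'.asymm, h''.asymm]
        · subst h''
          have : f i j i = 0 := by rw [h2, h0]
          simp [this]
        · simp [h, h', h'', h.asymm, h'.asymm, h''.asymm]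
      · subst h'
        have : f i j j = 0 := by rw [← e3, h0]
        simp [this]
      · simp [h, h', h.asymm, h'.asymm, (h'.trans h).asymm]
  have s12 : ∀ g : Fin n → Fin n → Fin n → R,
      ∑ i, ∑ j, ∑ k, g j i k = ∑ i, ∑ j, ∑ k, g i j k := fun g => Finset.sum_comm
  have s23 : ∀ g : Fin n → Fin n → Fin n → R,
      ∑ i, ∑ j, ∑ k, g i k j = ∑ i, ∑ j, ∑ k, g i j k := fun g =>
    Finset.sum_congr rfl fun i _ => Finset.sum_comm
  rw [hT]
  simp only [hf, Finset.sum_add_distrib]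
  rw [s23 T, s12 T, s12 fun i j k => T i k j, s23 T, s23 fun i j k => T j i k, s12 T,
    s12 fun i j k => T k i j, s23 fun i j k => T j i k, s12 T]
  ring

theorem sum_pairs [AddCommMonoid R] (f : Fin n → Fin n → R) :
    ∑ e : Pairs n, f e.1.1 e.1.2 = ∑ i, ∑ j with i < j, f i j := by
  simp only [Finset.sum_filter]
  rw [← Finset.sum_product', Finset.univ_product_univ, ← Finset.sum_filter]
  exact (Finset.sum_subtype (Finset.univ.filter fun e : Fin n × Fin n => e.1 < e.2)
    (fun e => by simp) fun e => f e.1 e.2).symm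

/-- This matches the range of `l` in `p_l` with the number of squares `c_{ij}²`, as Newton's
identities require. -/
theorem card_pairs (n : ℕ) : Fintype.card (Pairs n) = n.choose 2 := by
  have h1 := sum_sum_eq_two_mul (n := n) (fun i j => if i = j then (0 : ℕ) else 1)
    (by simp) (fun i j => if_congr eq_comm rfl rfl)
  have h2 : ∑ i : Fin n, ∑ j with i < j, (if i = j then (0 : ℕ) else 1) =
      Fintype.card (Pairs n) := by
    rw [← sum_pairs, Fintype.card_eq_sum_ones]
    exact Finset.sum_congr rfl fun e _ => if_neg e.2.ne
  have h3 : ∑ i : Fin n, ∑ j, (if i = j then (0 : ℕ) else 1) = n * (n - 1) := by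
    have : ∀ i : Fin n, ∑ j, (if i = j then (0 : ℕ) else 1) = n - 1 := fun i => by
      simp [Finset.sum_ite, Finset.filter_ne]
    simp [this]
  rw [h2, h3] at h1
  rw [Nat.choose_two_right, h1, Nat.mul_div_cancel_left _ two_pos]

end Sums

/-! ### Invariance of the generators under signed permutations -/

section Invariants

variable {n d : ℕ} (hd : 2 ≤ d)

theorem u_eq_sum (i : Fin n) : u (d := d) hd i = ∑ j : Fin n, c hd i j ^ 2 := by
  unfold u
  refine Finset.sum_subset (Finset.subset_univ _) fun j _ hj => ?_
  have : j = i := by simpa using hj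
  rw [this, c_self]
  ring

theorem p_eq_sum_pairs (l : ℕ) : p n (d := d) hd l = ∑ e : Pairs n, (c hd e.1.1 e.1.2 ^ 2) ^ l := by
  rw [sum_pairs fun i j : Fin n => (c (d := d) hd i j ^ 2) ^ l]
  simp only [p, pow_mul]

/-- At `l = 0` the identity fails, since each diagonal term would be `0 ^ 0 = 1`. -/
theorem two_mul_p {l : ℕ} (hl : 1 ≤ l) :
    2 * p n (d := d) hd l = ∑ i : Fin n, ∑ j : Fin n, c hd i j ^ (2 * l) := by
  rw [sum_sum_eq_two_mul]
  · rfl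
  · intro i
    rw [c_self, zero_pow (by omega)]
  · intro i j
    rw [c_swap, Even.neg_pow (even_two_mul l)]

/-- The summand of `z` at the indices `i`, `j`, `k`. -/
noncomputable def zTerm (i j k : Fin n) : RatFun (W₁ n d) :=
  (u hd i - u hd j) * (u hd j - u hd k) * (u hd k - u hd i) * (c hd i j * c hd j k * c hd k i)

theorem six_mul_z : 6 * z n (d := d) hd = ∑ i : Fin n, ∑ j : Fin n, ∑ k : Fin n, zTerm hd i j k := by
  rw [sum_sum_sum_eq_six_mul]
  · rfl
  · intro i j
    simp [zTerm]
  · intro i j k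
    unfold zTerm
    rw [c_swap hd i j, c_swap hd i k, c_swap hd j k]
    ring
  · intro i j k
    unfold zTerm
    rw [c_swap hd i j, c_swap hd k i, c_swap hd j k]
    ring

theorem sum_zTerm_comp (σ : Equiv.Perm (Fin n)) :
    ∑ i : Fin n, ∑ j : Fin n, ∑ k : Fin n, zTerm (d := d) hd (σ i) (σ j) (σ k) = 6 * z n hd := by
  rw [six_mul_z]
  refine Fintype.sum_equiv σ _ _ fun i => Fintype.sum_equiv σ _ _ fun j => ?_
  exact Fintype.sum_equiv σ _ _ fun k => rfl

/-- A homomorphism acting like a signed permutation on the `c_{ij}` fixes `p_l`, `q_l` and `z`. -/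
theorem map_invariants_eq (φ : RatFun (W₁ n d) →ₐ[ℝ] RatFun (W₁ n d))
    (σ : Equiv.Perm (Fin n)) (τ : Fin n → ℤˣ)
    (hφ : ∀ i j, φ (c hd i j) = ((τ i * τ j : ℤˣ) : ℤ) * c hd (σ i) (σ j)) :
    (∀ l, 1 ≤ l → φ (p n hd l) = p n hd l) ∧ (∀ l, φ (q n hd l) = q n hd l) ∧
      φ (z n hd) = z n hd := by
  have hτ : ∀ s : ℤˣ, (((s : ℤ) : RatFun (W₁ n d))) ^ 2 = 1 := fun s => by
    rcases Int.units_eq_one_or s with rfl | rfl <;> simp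
  have hsq : ∀ i j, φ (c hd i j) ^ 2 = c hd (σ i) (σ j) ^ 2 := fun i j => by
    rw [hφ, mul_pow, hτ, one_mul]
  have hu : ∀ i, φ (u hd i) = u hd (σ i) := fun i => by
    rw [u_eq_sum, u_eq_sum, map_sum]
    exact Fintype.sum_equiv σ _ _ fun j => by rw [map_pow, hsq]
  refine ⟨fun l hl => ?_, fun l => ?_, ?_⟩
  · have h2 : (2 : RatFun (W₁ n d)) ≠ 0 := two_ne_zero
    have hφp : 2 * φ (p n hd l) = φ (2 * p n hd l) := by rw [map_mul, map_ofNat]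
    rw [← mul_right_inj' h2, hφp, two_mul_p hd hl, map_sum]
    conv_rhs => rw [← Equiv.sum_comp σ]
    refine Finset.sum_congr rfl fun i _ => ?_
    conv_rhs => rw [← Equiv.sum_comp σ]
    rw [map_sum]
    refine Finset.sum_congr rfl fun j _ => ?_
    rw [map_pow, pow_mul, hsq, pow_mul]
  · unfold q
    rw [map_sum]
    conv_rhs => rw [← Equiv.sum_comp σ]
    exact Finset.sum_congr rfl fun i _ => by rw [map_pow, hu]
  · have h6 : (6 : RatFun (W₁ n d)) ≠ 0 := by norm_num
    have hφz : 6 * φ (z n hd) = φ (6 * z n hd) := by rw [map_mul, map_ofNat]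
    rw [← mul_right_inj' h6, hφz]
    conv_rhs => rw [← sum_zTerm_comp hd σ]
    rw [six_mul_z]
    simp only [map_sum]
    refine Finset.sum_congr rfl fun i _ => Finset.sum_congr rfl fun j _ =>
      Finset.sum_congr rfl fun k _ => ?_
    simp only [zTerm, map_mul, map_sub, hu, hφ, Units.val_mul, Int.cast_mul]
    -- Each index occurs twice in a triangle, so the sign is `τ_i² τ_j² τ_k²`; its difference from
    -- `1` telescopes through the three relations `τ² = 1`.
    linear_combination (u hd (σ i) - u hd (σ j)) * (u hd (σ j) - u hd (σ k)) *
      (u hd (σ k) - u hd (σ i)) * (c hd (σ i) (σ j) * c hd (σ j) (σ k) * c hd (σ k) (σ i)) *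
      (((τ i : ℤ) : RatFun (W₁ n d)) ^ 2 * ((τ j : ℤ) : RatFun (W₁ n d)) ^ 2 * hτ (τ k) +
        ((τ i : ℤ) : RatFun (W₁ n d)) ^ 2 * hτ (τ j) + hτ (τ i))

end Invariants

/-! ### Automorphisms fixing the invariants are signed permutations -/

/-- For every triangle there is an antisymmetric matrix at which no term of `z` is positive and the
term belonging to this triangle does not vanish. -/
theorem exists_triangle_matrix {n : ℕ} {a b e : Fin n} (hab : a ≠ b) (hbe : b ≠ e) (hea : e ≠ a) :
    ∃ A : Fin n → Fin n → ℝ, (∀ x y, A y x = -A x y) ∧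
      (∀ x y w, (∑ m, A x m ^ 2 - ∑ m, A y m ^ 2) * (∑ m, A y m ^ 2 - ∑ m, A w m ^ 2) *
        (∑ m, A w m ^ 2 - ∑ m, A x m ^ 2) * (A x y * A y w * A w x) ≤ 0) ∧
      (∑ m, A a m ^ 2 - ∑ m, A b m ^ 2) * (∑ m, A b m ^ 2 - ∑ m, A e m ^ 2) *
        (∑ m, A e m ^ 2 - ∑ m, A a m ^ 2) * (A a b * A b e * A e a) ≠ 0 := by
  -- The weights `1, 2, 3` on the oriented edges give distinct row sums `10, 5, 13`, and the
  -- triangle's term is `5 · (-8) · 3 · 6 < 0`. The term is symmetric in its indices, so every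
  -- ordering gives this value; all other terms are `0`.
  let B : Fin n → Fin n → ℝ := fun x y =>
    (if x = a ∧ y = b then 1 else 0) + (if x = b ∧ y = e then 2 else 0) +
      (if x = e ∧ y = a then 3 else 0)
  let A : Fin n → Fin n → ℝ := fun x y => B x y - B y x
  have hUa : ∑ y, A a y ^ 2 = 10 := by
    have : ∀ y, A a y ^ 2 = (if y = b then 1 else 0) + (if y = e then 9 else 0) := fun y => by
      simp only [A, B]; grind
    simp only [this, Finset.sum_add_distrib, Finset.sum_ite_eq', Finset.mem_univ, if_true]
    norm_num
  have hUb : ∑ y, A b y ^ 2 = 5 := by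
    have : ∀ y, A b y ^ 2 = (if y = a then 1 else 0) + (if y = e then 4 else 0) := fun y => by
      simp only [A, B]; grind
    simp only [this, Finset.sum_add_distrib, Finset.sum_ite_eq', Finset.mem_univ, if_true]
    norm_num
  have hUe : ∑ y, A e y ^ 2 = 13 := by
    have : ∀ y, A e y ^ 2 = (if y = a then 9 else 0) + (if y = b then 4 else 0) := fun y => by
      simp only [A, B]; grind
    simp only [this, Finset.sum_add_distrib, Finset.sum_ite_eq', Finset.mem_univ, if_true]
    norm_num
  have hA0 : ∀ x y, x ≠ a → x ≠ b → x ≠ e → A x y = 0 := fun x y h1 h2 h3 => by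
    simp [A, B, h1, h2, h3]
  have hAself : ∀ x, A x x = 0 := fun x => sub_self _
  have hAab : A a b = 1 := by simp [A, B, hab, hab.symm, hbe, hea.symm]
  have hAba : A b a = -1 := by simp [A, B, hab, hab.symm, hbe, hea.symm]
  have hAbe : A b e = 2 := by simp [A, B, hab.symm, hbe, hbe.symm, hea]
  have hAeb : A e b = -2 := by simp [A, B, hab.symm, hbe, hbe.symm, hea]
  have hAea : A e a = 3 := by simp [A, B, hab, hbe.symm, hea, hea.symm]
  have hAae : A a e = -3 := by simp [A, B, hab, hbe.symm, hea, hea.symm]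
  refine ⟨A, fun x y => by simp only [A]; ring, ?_, ?_⟩
  · intro x y w
    have hcase : ∀ x, (x = a ∨ x = b ∨ x = e) ∨ ∀ y, A x y = 0 := fun x => by
      by_contra! hx
      obtain ⟨⟨h1, h2, h3⟩, y, hy⟩ := hx
      exact hy (hA0 x y h1 h2 h3)
    rcases hcase x with hx | hx
    · rcases hcase y with hy | hy
      · rcases hcase w with hw | hw
        · rcases hx with h1 | h1 | h1 <;> rcases hy with h2 | h2 | h2 <;>
            rcases hw with h3 | h3 | h3 <;> rw [h1, h2, h3] <;>
            simp only [hUa, hUb, hUe, hAself, hAab, hAba, hAbe, hAeb, hAea, hAae] <;> norm_num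
        · simp [hw]
      · simp [hy]
    · simp [hx]
  · rw [hUa, hUb, hUe, hAab, hAbe, hAea]
    norm_num

section Automorphisms

variable {n d : ℕ} (hd : 2 ≤ d)

-- If `φ(c_{ij}²) = c_{kl}²`, then applying `φ` to `u_i` and to `u_j` places `c_{kl}²` in both `u_{σ
-- i}` and `u_{σ j}`, so `{k, l} = {σ i, σ j}`.
open MvPolynomial in
theorem map_c_sq_eq (φ : RatFun (W₁ n d) →ₐ[ℝ] RatFun (W₁ n d)) (σ : Equiv.Perm (Fin n))
    (hc : ∀ i j, i ≠ j → ∃ k l, k ≠ l ∧ φ (c hd i j ^ 2) = c hd k l ^ 2)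
    (hu : ∀ i, φ (u hd i) = u hd (σ i)) (i j : Fin n) :
    φ (c hd i j) ^ 2 = c hd (σ i) (σ j) ^ 2 := by
  have hc' : ∀ i j, ∃ e : Fin n × Fin n, φ (c hd i j ^ 2) = c hd e.1 e.2 ^ 2 := fun i j => by
    by_cases h : i = j
    · subst h
      exact ⟨(i, i), by simp [c_self]⟩
    · obtain ⟨k, l, -, he⟩ := hc i j h
      exact ⟨(k, l), he⟩
  choose π hπ using hc'
  have hswap : ∀ k l : Fin n, c (d := d) hd l k ^ 2 = c hd k l ^ 2 := fun k l => by
    rw [c_swap, neg_sq]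
  have hmem : ∀ i j k l, k ≠ l → φ (c hd i j ^ 2) = c hd k l ^ 2 → σ i = k ∨ σ i = l := by
    intro i j k l hkl he
    let P : MvPolynomial (Fin n × Fin n) ℝ :=
      ∑ m, X (σ i, m) ^ 2 - (X (k, l) ^ 2 + ∑ m ∈ Finset.univ.erase j, X (π i m) ^ 2)
    have hP : aeval (fun e : Fin n × Fin n => c (d := d) hd e.1 e.2) P = 0 := by
      have h := hu i
      rw [u_eq_sum, u_eq_sum, map_sum, ← Finset.add_sum_erase _ _ (Finset.mem_univ j), he] at h
      simp only [hπ] at h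
      simp only [P, map_sub, map_add, map_sum, map_pow, aeval_X, h, sub_self]
    by_contra! hne
    -- Only the entries at `(k, l)` and `(l, k)` are nonzero. If `σ i` were neither index, `u_{σ i}`
    -- would vanish here, yet equal `1` plus a sum of squares.
    let A : Fin n → Fin n → ℝ := fun x y =>
      (if x = k ∧ y = l then 1 else 0) - (if x = l ∧ y = k then 1 else 0)
    have h := eval_eq_zero_of_aeval_c_eq_zero hd P hP A fun x y => by
      simp only [A, and_comm (a := y = _)]; ring
    have h0 : ∀ m, A (σ i) m = 0 := fun m => by simp [A, hne.1, hne.2]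
    have h1 : A k l = 1 := by simp [A, hkl]
    simp only [P, map_sub, map_add, map_sum, map_pow, eval_X, h0, h1] at h
    have hle : 0 ≤ ∑ m ∈ Finset.univ.erase j, A (π i m).1 (π i m).2 ^ 2 :=
      Finset.sum_nonneg fun m _ => sq_nonneg _
    simp only [ne_eq, OfNat.ofNat_ne_zero, not_false_eq_true, zero_pow, Finset.sum_const_zero] at h
    linarith
  rw [← map_pow]
  by_cases hij : i = j
  · subst hij
    simp [c_self]
  · obtain ⟨k, l, hkl, he⟩ := hc i j hij
    have hσ : σ i ≠ σ j := fun h => hij (σ.injective h)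
    have hj := hmem j i k l hkl (by rw [hswap, he])
    rw [he]
    rcases hmem i j k l hkl he with rfl | rfl
    · rw [hj.resolve_left (Ne.symm hσ)]
    · rw [hj.resolve_right (Ne.symm hσ), hswap]

open MvPolynomial in
/-- If `φ` fixes `z`, then the signs in the action of `φ` on the `c_{ij}` multiply to `1` along
every triangle. -/
theorem sign_triangle (φ : RatFun (W₁ n d) →ₐ[ℝ] RatFun (W₁ n d)) (σ : Equiv.Perm (Fin n))
    (ε : Fin n → Fin n → ℤˣ) (hε : ∀ i j, φ (c hd i j) = ((ε i j : ℤˣ) : ℤ) * c hd (σ i) (σ j))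
    (hu : ∀ i, φ (u hd i) = u hd (σ i)) (hz : φ (z n hd) = z n hd)
    {i j k : Fin n} (hij : i ≠ j) (hjk : j ≠ k) (hki : k ≠ i) :
    ε i j * ε j k * ε k i = 1 := by
  let U : Fin n → MvPolynomial (Fin n × Fin n) ℝ := fun x => ∑ y, X (x, y) ^ 2
  let T : Fin n → Fin n → Fin n → MvPolynomial (Fin n × Fin n) ℝ := fun x y w =>
    (U x - U y) * (U y - U w) * (U w - U x) * (X (x, y) * X (y, w) * X (w, x))
  -- This expresses `6z - φ(6z) = 0`, with `6z` reindexed along `σ` so that corresponding terms can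
  -- be compared.
  let P : MvPolynomial (Fin n × Fin n) ℝ := ∑ x, ∑ y, ∑ w,
    (1 - C (((ε x y * ε y w * ε w x : ℤˣ) : ℤ) : ℝ)) * T (σ x) (σ y) (σ w)
  have hP : aeval (fun e : Fin n × Fin n => c (d := d) hd e.1 e.2) P = 0 := by
    have hU : ∀ x, aeval (fun e : Fin n × Fin n => c (d := d) hd e.1 e.2) (U x) = u hd x :=
      fun x => by simp only [U, u_eq_sum, map_sum, map_pow, aeval_X]
    have hT : ∀ x y w, aeval (fun e : Fin n × Fin n => c (d := d) hd e.1 e.2) (T x y w) =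
        zTerm hd x y w := fun x y w => by
      simp only [T, zTerm, map_mul, map_sub, hU, aeval_X]
    have h1 : φ (6 * z n hd) = 6 * z n hd := by rw [map_mul, hz, map_ofNat]
    conv_rhs at h1 => rw [← sum_zTerm_comp hd σ]
    rw [six_mul_z] at h1
    have h2 : ∀ x y w, φ (zTerm hd x y w) =
        ((ε x y * ε y w * ε w x : ℤˣ) : ℤ) * zTerm hd (σ x) (σ y) (σ w) := fun x y w => by
      simp only [zTerm, map_mul, map_sub, hu, hε, Units.val_mul, Int.cast_mul]
      ring
    simp only [map_sum, h2] at h1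
    simp only [P, map_sum, map_mul, map_sub, hT, map_intCast, sub_mul, one_mul,
      Finset.sum_sub_distrib]
    exact sub_eq_zero.2 h1.symm
  obtain ⟨A, hA, ht, htn⟩ := exists_triangle_matrix (σ.injective.ne hij) (σ.injective.ne hjk)
    (σ.injective.ne hki)
  have h := eval_eq_zero_of_aeval_c_eq_zero hd P hP A hA
  let t : Fin n → Fin n → Fin n → ℝ := fun x y w =>
    (∑ m, A x m ^ 2 - ∑ m, A y m ^ 2) * (∑ m, A y m ^ 2 - ∑ m, A w m ^ 2) *
      (∑ m, A w m ^ 2 - ∑ m, A x m ^ 2) * (A x y * A y w * A w x)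
  have hpos : ∀ s : ℤˣ, 0 ≤ 1 - ((s : ℤ) : ℝ) := fun s => by
    rcases Int.units_eq_one_or s with rfl | rfl <;> norm_num
  have heval : ∑ x, ∑ y, ∑ w, (1 - (((ε x y * ε y w * ε w x : ℤˣ) : ℤ) : ℝ)) *
      -t (σ x) (σ y) (σ w) = 0 := by
    simp only [mul_neg, Finset.sum_neg_distrib, neg_eq_zero]
    rw [← h]
    simp only [P, T, U, t, map_sum, map_mul, map_sub, map_one, map_pow, eval_X, eval_C]
  have hnn : ∀ x y w, 0 ≤ (1 - (((ε x y * ε y w * ε w x : ℤˣ) : ℤ) : ℝ)) *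
      -t (σ x) (σ y) (σ w) := fun x y w =>
    mul_nonneg (hpos _) (neg_nonneg.2 (ht _ _ _))
  -- A vanishing sum of nonnegative terms has only zero terms; the term of the chosen triangle then
  -- forces its sign factor to vanish.
  rw [Finset.sum_eq_zero_iff_of_nonneg fun x _ => Finset.sum_nonneg fun y _ =>
    Finset.sum_nonneg fun w _ => hnn x y w] at heval
  have heval := heval i (Finset.mem_univ _)
  rw [Finset.sum_eq_zero_iff_of_nonneg fun y _ => Finset.sum_nonneg fun w _ => hnn i y w] at heval
  have heval := heval j (Finset.mem_univ _)
  rw [Finset.sum_eq_zero_iff_of_nonneg fun w _ => hnn i j w] at heval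
  have heval := heval k (Finset.mem_univ _)
  have hone := (mul_eq_zero.1 heval).resolve_right (neg_ne_zero.2 htn)
  rcases Int.units_eq_one_or (ε i j * ε j k * ε k i) with h' | h'
  · exact h'
  · rw [h'] at hone
    norm_num at hone

/-- A sign function on the edges of a complete graph with product `1` on all triangles is a
coboundary: fix a vertex `o` and put `τ_i = ε_{oi}`. -/
theorem exists_signs (φ : RatFun (W₁ n d) →ₐ[ℝ] RatFun (W₁ n d)) (σ : Equiv.Perm (Fin n))
    (hsq : ∀ i j, φ (c hd i j) ^ 2 = c hd (σ i) (σ j) ^ 2)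
    (hu : ∀ i, φ (u hd i) = u hd (σ i)) (hz : φ (z n hd) = z n hd) :
    ∃ τ : Fin n → ℤˣ, ∀ i j, φ (c hd i j) = ((τ i * τ j : ℤˣ) : ℤ) * c hd (σ i) (σ j) := by
  classical
  let ε : Fin n → Fin n → ℤˣ := fun i j => if φ (c hd i j) = c hd (σ i) (σ j) then 1 else -1
  have hε : ∀ i j, φ (c hd i j) = ((ε i j : ℤˣ) : ℤ) * c hd (σ i) (σ j) := fun i j => by
    simp only [ε]
    split_ifs with h
    · simp [h]
    · simpa using (sq_eq_sq_iff_eq_or_eq_neg.1 (hsq i j)).resolve_left h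
  -- As `c_{ii} = 0`, either sign would be admissible on the diagonal; the choice of `1` gives `τ_o
  -- = 1`.
  have hself : ∀ i, ε i i = 1 := fun i => if_pos (by rw [c_self, c_self, map_zero])
  have hsymm : ∀ i j, ε i j = ε j i := fun i j =>
    if_congr (by rw [c_swap hd j i, c_swap hd (σ j) (σ i), map_neg, neg_inj]) rfl rfl
  have hmul : ∀ s : ℤˣ, s * s = 1 := Int.units_mul_self
  rcases isEmpty_or_nonempty (Fin n) with hn | ⟨⟨o⟩⟩
  · exact ⟨1, fun i => hn.elim i⟩
  refine ⟨ε o, fun i j => ?_⟩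
  rw [hε]
  suffices h : ε i j = ε o i * ε o j by rw [h]
  by_cases h1 : o = i
  · subst h1; rw [hself, one_mul]
  by_cases h2 : o = j
  · subst h2; rw [hself, mul_one, hsymm]
  by_cases h3 : i = j
  · subst h3; rw [hself, hmul]
  have h := sign_triangle hd φ σ ε hε hu hz h1 h3 (Ne.symm h2)
  rw [hsymm j o] at h
  calc ε i j = (ε o i * ε i j * ε o j) * (ε o i * ε o j) := by
        rw [show ∀ a b e : ℤˣ, (a * b * e) * (a * e) = b * ((a * a) * (e * e)) by intros; ac_rfl,
          hmul, hmul, mul_one, mul_one]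
    _ = ε o i * ε o j := by rw [h, one_mul]

theorem algHom_ext_of_c {φ ψ : RatFun (W₁ n d) →ₐ[ℝ] RatFun (W₁ n d)}
    (h : ∀ i j : Fin n, φ (c hd i j) = ψ (c hd i j)) : φ = ψ := by
  refine AlgHom.ext fun x => ?_
  have hx : x ∈ IntermediateField.adjoin ℝ
      (Set.range fun e : Pairs n => c (d := d) hd e.1.1 e.1.2) := by
    rw [adjoin_c_eq_top]; trivial
  induction hx using IntermediateField.adjoin_induction with
  | mem x hx => obtain ⟨e, rfl⟩ := hx; exact h _ _
  | algebraMap r => rw [φ.commutes, ψ.commutes]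
  | add x y _ _ h1 h2 => rw [map_add, map_add, h1, h2]
  | inv x _ h1 => rw [map_inv₀, map_inv₀, h1]
  | mul x y _ _ h1 h2 => rw [map_mul, map_mul, h1, h2]

end Automorphisms

end RationalInvariants

/-! ### The main theorem -/

open RationalInvariants in
theorem mainTheorem3 (n d : ℕ) (hd : 2 ≤ d) :
    IntermediateField.adjoin ℝ
        ({f | ∃ l : ℕ, 1 ≤ l ∧ l ≤ n.choose 2 ∧ f = RationalInvariants.p n hd l} ∪
          {f | ∃ l : ℕ, 2 ≤ l ∧ l ≤ n ∧ f = RationalInvariants.q n hd l} ∪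
          {RationalInvariants.z n hd}) =
      RationalInvariants.ratInvariants (RationalInvariants.repW₁ n d) := by
  apply le_antisymm
  · rw [IntermediateField.adjoin_le_iff]
    intro f hf
    refine (mem_ratInvariants _ f).2 fun g => ?_
    obtain ⟨σ, τ, hg⟩ := g.2
    obtain ⟨hp, hq, hz⟩ := map_invariants_eq hd
      (AlgEquiv.toAlgHom (ratAct (repW₁ n d) g)) σ τ
      fun i j => ratAct_c hd g hg i j
    rcases hf with (⟨l, hl, -, rfl⟩ | ⟨l, -, -, rfl⟩) | rfl
    · exact hp l hl
    · exact hq l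
    · exact hz
  · set K := IntermediateField.adjoin ℝ
        ({f | ∃ l : ℕ, 1 ≤ l ∧ l ≤ n.choose 2 ∧ f = RationalInvariants.p n hd l} ∪
          {f | ∃ l : ℕ, 2 ≤ l ∧ l ≤ n ∧ f = RationalInvariants.q n hd l} ∪
          {RationalInvariants.z n hd})
    have hpK : ∀ l, 1 ≤ l → l ≤ n.choose 2 → p n hd l ∈ K := fun l h1 h2 =>
      IntermediateField.subset_adjoin _ _ (Or.inl (Or.inl ⟨l, h1, h2, rfl⟩))
    have hzK : z n hd ∈ K := IntermediateField.subset_adjoin _ _ (Or.inr rfl)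
    have hps : ∀ l, 1 ≤ l → l ≤ Fintype.card (Pairs n) →
        ∑ e : Pairs n, (c (d := d) hd e.1.1 e.1.2 ^ 2) ^ l ∈ K := fun l h1 h2 => by
      rw [← p_eq_sum_pairs]
      exact hpK l h1 (card_pairs n ▸ h2)
    have hqs : ∀ l, 1 ≤ l → l ≤ Fintype.card (Fin n) →
        ∑ i : Fin n, u (d := d) hd i ^ l ∈ K := by
      intro l h1 h2
      rw [Fintype.card_fin] at h2
      rcases h1.eq_or_lt with rfl | h1
      -- The first power sum of the `u_i` is not among the generators `q_l`, but it counts every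
      -- `c_{ij}²` twice.
      · have h : ∑ i : Fin n, u (d := d) hd i ^ 1 = 2 * p n hd 1 := by
          rw [two_mul_p hd le_rfl]
          exact Finset.sum_congr rfl fun i _ => by rw [pow_one, u_eq_sum]
        rw [h]
        refine K.mul_mem (ofNat_mem K 2) ?_
        -- For `n ≤ 1` the family of the `p_l` is empty, and `p_1` is an empty sum.
        rcases Nat.eq_zero_or_pos (n.choose 2) with h0 | h0
        · have : IsEmpty (Pairs n) := by rw [← Fintype.card_eq_zero_iff, card_pairs, h0]
          rw [p_eq_sum_pairs, Finset.univ_eq_empty, Finset.sum_empty]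
          exact K.zero_mem
        · exact hpK 1 le_rfl h0
      · exact IntermediateField.subset_adjoin _ _ (Or.inl (Or.inr ⟨l, h1, h2, rfl⟩))
    obtain ⟨hfin, hgal⟩ := isGalois_of_powerSums_sq_mem K
      (fun e : Pairs n => c (d := d) hd e.1.1 e.1.2) hps (adjoin_c_eq_top hd)
    intro x hx
    have hx := (mem_ratInvariants _ x).1 hx
    refine mem_of_forall_gal_eq K fun φ => ?_
    obtain ⟨σ, hσ⟩ := exists_perm_of_powerSums_mem K (fun i : Fin n => u (d := d) hd i) hqs φ
    obtain ⟨π, hπ⟩ := exists_perm_of_powerSums_mem K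
      (fun e : Pairs n => c (d := d) hd e.1.1 e.1.2 ^ 2) hps φ
    let φ' : RatFun (W₁ n d) →ₐ[ℝ] RatFun (W₁ n d) := φ.toAlgHom.restrictScalars ℝ
    have hc : ∀ i j : Fin n, i ≠ j →
        ∃ k l : Fin n, k ≠ l ∧ φ' (c hd i j ^ 2) = c hd k l ^ 2 := by
      intro i j hij
      rcases lt_or_gt_of_ne hij with h | h
      · exact ⟨_, _, (π ⟨(i, j), h⟩).2.ne, hπ ⟨(i, j), h⟩⟩
      · refine ⟨_, _, (π ⟨(j, i), h⟩).2.ne, ?_⟩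
        rw [c_swap, neg_sq]
        exact hπ ⟨(j, i), h⟩
    have hz : φ' (z n hd) = z n hd := φ.commutes ⟨_, hzK⟩
    obtain ⟨τ, hτ⟩ := exists_signs hd φ' σ (map_c_sq_eq hd φ' σ hc hσ) hσ hz
    obtain ⟨g, hg⟩ := exists_isSignedPerm σ τ
    have heq : φ' = (AlgEquiv.toAlgHom (ratAct (repW₁ n d) g)) :=
      algHom_ext_of_c hd fun i j => (hτ i j).trans (ratAct_c hd g hg i j).symm
    exact (DFunLike.congr_fun heq x).trans (hx g)
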